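/- **Theorem.** Let $n$ be a positive integer, let $a\le b$ be real numbers, and let $\phi:\{1,\dots,n\}\to[a,b]$. For a tree $T$ with vertex set $\{1,\dots,n\}$ put $$F(T)=\sum_{\{j,k\}\in E(T)}\phi(j)\phi(k).$$ Let $x=(x_1,\dots,x_n)$ be a tree degree sequence, i.e. a sequence of positive integers with $\sum_{j=1}^n x_j=2n-2$. Let $\mathcal T_x$ be the (finite) set of all trees on the vertex set $\{1,\dots,n\}$ in which vertex $j$ has degree $x_j$ for every $j$, and let $$\bar F(x)=\frac1{|\mathcal T_x|}\sum_{T\in\mathcal T_x}F(T).$$ Define $$\|\phi\|_m=\min_{c\in\mathbb R}\sum_{j=1}^n|\phi(j)-c|,\qquad L_\phi=(b-a)^3\,\min\bigl\{(b-a)\,n,\ \|\phi\|_m\,(\ln n+2)\bigr\}.$$ Then for each $\xi\in\{-1,1\}$ there is a real number $K$ with $0\le K\le \tfrac18 L_\phi$ such that $$\frac1{|\mathcal T_x|}\sum_{T\in\mathcal T_x}e^{\xi F(T)}=\exp\bigl(\xi\bar F(x)+K\bigr).$$ Furthermore, if $\widehat T$ is a uniformly random element of $\mathcal T_x$, then for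 every real $t>0$, $$\mathbb P\bigl(|F(\widehat T)-\bar F(x)|>t\bigr)\le 2\exp\bigl(-2t^2/L_\phi\bigr),$$ where for $L_\phi=0$ the right-hand side is read as $0$. -/

import Mathlib

namespace TreeDegree

/-- A sequence of positive integers of length `n` is a tree degree sequence if its entries sum to
`2 n - 2` (written without truncated subtraction). -/
def IsTreeDegreeSeq {n : ℕ} (x : Fin n → ℕ) : Prop :=
  (∀ j, 0 < x j) ∧ ∑ j, x j + 2 = 2 * n

open Classical in
/-- The finite set of all labelled trees on the vertex set `Fin n` in which every vertex `j` has
degree `x j`. -/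
noncomputable def trees {n : ℕ} (x : Fin n → ℕ) : Finset (SimpleGraph (Fin n)) :=
  Finset.univ.filter fun T => T.IsTree ∧ ∀ j, T.degree j = x j

open Classical in
/-- `F(T)`: the sum over the (unordered) edges `{j, k}` of `T` of `φ j * φ k`. -/
noncomputable def edgeSum {n : ℕ} (φ : Fin n → ℝ) (T : SimpleGraph (Fin n)) : ℝ :=
  ∑ e ∈ T.edgeFinset, Sym2.lift ⟨fun j k => φ j * φ k, fun j k => mul_comm (φ j) (φ k)⟩ e

/-- The average value of `g` over all trees with degree sequence `x`. -/
noncomputable def treeAverage {n : ℕ} (x : Fin n → ℕ) (g : SimpleGraph (Fin n) → ℝ) : ℝ :=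
  (1 / ((trees x).card : ℝ)) * ∑ T ∈ trees x, g T

open Classical in
/-- The probability that a uniformly random tree with degree sequence `x` satisfies `p`. -/
noncomputable def treeProb {n : ℕ} (x : Fin n → ℕ) (p : SimpleGraph (Fin n) → Prop) : ℝ :=
  (((trees x).filter p).card : ℝ) / ((trees x).card : ℝ)

/-- The seminorm `‖φ‖_m = min_c ∑ j, |φ j - c|`. -/
noncomputable def medianSeminorm {n : ℕ} (φ : Fin n → ℝ) : ℝ :=
  ⨅ c : ℝ, ∑ j, |φ j - c|

/-- The infimum defining `medianSeminorm` is a minimum. -/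
theorem medianSeminorm_isLeast {n : ℕ} (φ : Fin n → ℝ) :
    IsLeast (Set.range fun c : ℝ => ∑ j, |φ j - c|) (medianSeminorm φ) := by
  have hbdd : BddBelow (Set.range fun c : ℝ => ∑ j, |φ j - c|) :=
    ⟨0, by rintro _ ⟨c, rfl⟩; exact Finset.sum_nonneg fun j _ => abs_nonneg _⟩
  suffices h : ∃ c : ℝ, ∀ c' : ℝ, ∑ j, |φ j - c| ≤ ∑ j, |φ j - c'| by
    obtain ⟨c, hc⟩ := h
    have heq : medianSeminorm φ = ∑ j, |φ j - c| :=
      le_antisymm (ciInf_le hbdd c) (le_ciInf hc)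
    exact ⟨⟨c, heq.symm⟩, by rintro _ ⟨c', rfl⟩; exact ciInf_le hbdd c'⟩
  rcases n with _ | n
  · exact ⟨0, by simp⟩
  · refine Continuous.exists_forall_le (by fun_prop) ?_
    have h1 : Filter.Tendsto (fun c : ℝ => |φ 0 - c|) (Filter.cocompact ℝ) Filter.atTop := by
      refine Filter.tendsto_atTop_mono (f := fun c : ℝ => ‖c‖ + -|φ 0|) (fun c => ?_)
        (Filter.tendsto_atTop_add_const_right _ _ (tendsto_norm_cocompact_atTop (E := ℝ)))
      have := abs_sub_abs_le_abs_sub c (φ 0)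
      rw [abs_sub_comm] at this
      simpa [Real.norm_eq_abs, sub_eq_add_neg] using this
    exact Filter.tendsto_atTop_mono (fun c =>
      Finset.single_le_sum (f := fun j => |φ j - c|) (fun j _ => abs_nonneg _)
        (Finset.mem_univ 0)) h1

/-- `L_φ = (b - a)³ min {(b - a) n, ‖φ‖_m (ln n + 2)}`. -/
noncomputable def rangeBound {n : ℕ} (φ : Fin n → ℝ) (a b : ℝ) : ℝ :=
  (b - a) ^ 3 * min ((b - a) * n) (medianSeminorm φ * (Real.log n + 2))

end TreeDegree

/-! Put y_j = x_j - 1, the excess of j; the total excess is n - 2, so some v has y_v = 0 and is a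
leaf in every tree. Deleting v and recording its neighbour j is a bijection onto pairs of a j with
y_j > 0 and a tree on the other vertices in which the excess of j has dropped by one
(`sum_treesWithExcess_eq_sum_dropLeaf`). This recursion yields the multinomial count, so for n ≥ 3
the neighbour of v is j with probability y_j / (n - 2), and given j the rest is again a uniform tree
with prescribed degrees.

The same recursion gives the mean of F in closed form, and from it the exact effect of moving the
leaf v from k to j: the conditional mean changes by (φ_j - φ_k)(φ_v - average of φ over R), where R
consists of the vertices other than v, j, k (`mul_edgeProductMean_dropLeaf_sub`). Deleting leaves
one at a time and applying Hoeffding's lemma to each choice of neighbour bounds E exp(sF) by exp(s E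
F + s²L/8), where L sums bounds on the squared spreads (`edgeProductMean_exp_le`).

Each squared spread is at most (b-a)⁴, and also at most (b-a)³(|φ_v - c| + M/|R|) with M = ∑|φ_u -
c|. Since |R| decreases by one per deletion, the second bound sums to M plus M times a harmonic sum,
whence the two terms of the minimum in L_φ. Jensen gives K ≥ 0, s = ±1 gives the upper bound on K,
and Chernoff's method gives the tail. -/

open Classical in
/-- The trees on `V` in which every vertex `j` has degree `y j + 1`. -/
noncomputable def treesWithExcess {V : Type*} [Fintype V] (y : V → ℕ) : Finset (SimpleGraph V) :=
  Finset.univ.filter fun T => T.IsTree ∧ ∀ j, T.degree j = y j + 1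

open Classical in
/-- The sum over the edges `{j, k}` of `T` of `φ j * φ k`. -/
noncomputable def edgeProductSum {V : Type*} [Fintype V] (φ : V → ℝ) (T : SimpleGraph V) : ℝ :=
  ∑ e ∈ T.edgeFinset, Sym2.lift ⟨fun j k => φ j * φ k, fun j k => mul_comm (φ j) (φ k)⟩ e

/-- Attach the vertex `v` as a leaf adjacent to `j`. -/
def attachLeaf {V : Type*} (v : V) (j : {u // u ≠ v}) (T : SimpleGraph {u // u ≠ v}) :
    SimpleGraph V where
  Adj a b := (∃ ha hb, T.Adj ⟨a, ha⟩ ⟨b, hb⟩) ∨ (a = v ∧ b = j) ∨ (a = j ∧ b = v)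
  symm := ⟨by
    rintro a b (⟨ha, hb, h⟩ | ⟨h, h'⟩ | ⟨h, h'⟩)
    · exact Or.inl ⟨hb, ha, h.symm⟩
    · exact Or.inr (Or.inr ⟨h', h⟩)
    · exact Or.inr (Or.inl ⟨h', h⟩)⟩
  loopless := ⟨by
    rintro a (⟨ha, hb, h⟩ | ⟨h, h'⟩ | ⟨h, h'⟩)
    · exact h.ne rfl
    · exact j.2 (h'.symm.trans h)
    · exact j.2 (h.symm.trans h')⟩

/-! ### Attaching and deleting a leaf. -/

section attachLeaf

variable {V : Type*} {v : V}

theorem attachLeaf_adj {j : {u // u ≠ v}} {T : SimpleGraph {u // u ≠ v}} {a b : V} :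
    (attachLeaf v j T).Adj a b ↔
      (∃ ha hb, T.Adj ⟨a, ha⟩ ⟨b, hb⟩) ∨ (a = v ∧ b = j) ∨ (a = j ∧ b = v) := Iff.rfl

theorem attachLeaf_adj_leaf {j : {u // u ≠ v}} {T : SimpleGraph {u // u ≠ v}} {b : V} :
    (attachLeaf v j T).Adj v b ↔ b = j := by
  rw [attachLeaf_adj]
  constructor
  · rintro (⟨ha, -⟩ | ⟨-, h⟩ | ⟨h, -⟩)
    · exact absurd rfl ha
    · exact h
    · exact absurd h.symm j.2
  · intro h
    exact Or.inr (Or.inl ⟨rfl, h⟩)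

theorem attachLeaf_adj_coe {j u w : {u // u ≠ v}} {T : SimpleGraph {u // u ≠ v}} :
    (attachLeaf v j T).Adj u w ↔ T.Adj u w := by
  rw [attachLeaf_adj]
  constructor
  · rintro (⟨_, _, h⟩ | ⟨h, -⟩ | ⟨-, h⟩)
    · exact h
    · exact absurd h u.2
    · exact absurd h w.2
  · intro h
    exact Or.inl ⟨u.2, w.2, h⟩

theorem comap_attachLeaf (j : {u // u ≠ v}) (T : SimpleGraph {u // u ≠ v}) :
    (attachLeaf v j T).comap Subtype.val = T := by
  ext u w
  exact attachLeaf_adj_coe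

theorem attachLeaf_comap {j : {u // u ≠ v}} {T : SimpleGraph V} (h : ∀ b, T.Adj v b ↔ b = j) :
    attachLeaf v j (T.comap Subtype.val) = T := by
  ext a b
  by_cases ha : a = v
  · subst ha
    rw [attachLeaf_adj_leaf, h]
  by_cases hb : b = v
  · subst hb
    rw [SimpleGraph.adj_comm, attachLeaf_adj_leaf, SimpleGraph.adj_comm, h]
  · exact attachLeaf_adj_coe (u := ⟨a, ha⟩) (w := ⟨b, hb⟩)

theorem connected_attachLeaf {j : {u // u ≠ v}} {T : SimpleGraph {u // u ≠ v}}
    (hT : T.Connected) : (attachLeaf v j T).Connected := by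
  have key : ∀ u, (attachLeaf v j T).Reachable u j := by
    intro u
    by_cases hu : u = v
    · subst hu
      exact (attachLeaf_adj_leaf.2 rfl : (attachLeaf u j T).Adj u j).reachable
    · exact (hT.preconnected ⟨u, hu⟩ j).map
        (⟨Subtype.val, fun h => attachLeaf_adj_coe.2 h⟩ : T →g attachLeaf v j T)
  have : Nonempty V := ⟨v⟩
  exact ⟨fun u w => (key u).trans (key w).symm⟩

variable [Fintype V]

open Classical in
theorem edgeFinset_attachLeaf (j : {u // u ≠ v}) (T : SimpleGraph {u // u ≠ v}) :
    (attachLeaf v j T).edgeFinset =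
      insert s(v, (j : V)) (T.edgeFinset.map (Function.Embedding.subtype (· ≠ v)).sym2Map) := by
  ext e
  induction e using Sym2.ind with
  | _ a b =>
    simp only [SimpleGraph.mem_edgeFinset, SimpleGraph.mem_edgeSet, Finset.mem_insert,
      Finset.mem_map, attachLeaf_adj, Sym2.exists, Function.Embedding.sym2Map_apply, Sym2.map_mk,
      Function.Embedding.subtype_apply, Sym2.eq_iff]
    constructor
    · rintro (⟨ha, hb, h⟩ | h | h)
      · exact Or.inr ⟨⟨a, ha⟩, ⟨b, hb⟩, h, Or.inl ⟨rfl, rfl⟩⟩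
      · exact Or.inl (Or.inl h)
      · exact Or.inl (Or.inr h)
    · rintro (h | ⟨u, w, h, ⟨rfl, rfl⟩ | ⟨rfl, rfl⟩⟩)
      · exact Or.inr h
      · exact Or.inl ⟨u.2, w.2, h⟩
      · exact Or.inl ⟨w.2, u.2, h.symm⟩

open Classical in
theorem leafEdge_notMem_map (j : {u // u ≠ v}) (T : SimpleGraph {u // u ≠ v}) :
    s(v, (j : V)) ∉ T.edgeFinset.map (Function.Embedding.subtype (· ≠ v)).sym2Map := by
  simp only [Finset.mem_map, Sym2.exists, Function.Embedding.sym2Map_apply, Sym2.map_mk,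
      Function.Embedding.subtype_apply, Sym2.eq_iff, not_exists, not_and]
  rintro u w - (⟨h, -⟩ | ⟨-, h⟩)
  · exact u.2 h
  · exact w.2 h

open Classical in
theorem edgeProductSum_attachLeaf (φ : V → ℝ) (j : {u // u ≠ v})
    (T : SimpleGraph {u // u ≠ v}) :
    edgeProductSum φ (attachLeaf v j T) =
      φ v * φ j + edgeProductSum (fun u : {u // u ≠ v} => φ u) T := by
  unfold edgeProductSum
  rw [edgeFinset_attachLeaf, Finset.sum_insert (leafEdge_notMem_map j T), Finset.sum_map]
  congr 1
  refine Finset.sum_congr (by ext; simp) fun e _ => ?_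
  induction e using Sym2.ind with
  | _ a b => rfl

-- Connectivity survives, and one vertex and one edge are added, so the edge count still
-- characterises a tree.
open Classical in
theorem isTree_attachLeaf {j : {u // u ≠ v}} {T : SimpleGraph {u // u ≠ v}}
    (hT : T.IsTree) : (attachLeaf v j T).IsTree := by
  rw [SimpleGraph.isTree_iff_connected_and_card]
  refine ⟨connected_attachLeaf hT.connected, ?_⟩
  have h := hT.card_edgeFinset
  rw [Nat.card_eq_fintype_card, Nat.card_eq_fintype_card, ← SimpleGraph.edgeFinset_card,
    edgeFinset_attachLeaf, Finset.card_insert_of_notMem (leafEdge_notMem_map j T),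
    Finset.card_map, h, Fintype.card_subtype_compl, Fintype.card_subtype_eq]
  have : 0 < Fintype.card V := Fintype.card_pos_iff.2 ⟨v⟩
  omega

open Classical in
theorem isTree_comap_of_degree_eq_one {T : SimpleGraph V} (hT : T.IsTree) (h : T.degree v = 1) :
    (T.comap (Subtype.val : {u // u ≠ v} → V)).IsTree :=
  ⟨hT.connected.induce_compl_singleton_of_degree_eq_one h,
    hT.isAcyclic.of_comap (Function.Embedding.subtype (· ≠ v))⟩

open Classical in
theorem degree_attachLeaf (j u : {u // u ≠ v}) (T : SimpleGraph {u // u ≠ v}) :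
    (attachLeaf v j T).degree (u : V) = T.degree u + if u = j then 1 else 0 := by
  have h : (attachLeaf v j T).neighborFinset u =
      (T.neighborFinset u).map (Function.Embedding.subtype (· ≠ v)) ∪
        if u = j then {v} else ∅ := by
    ext w
    simp only [SimpleGraph.mem_neighborFinset, Finset.mem_union, Finset.mem_map,
      Function.Embedding.subtype_apply]
    by_cases hw : w = v
    · subst hw
      rw [SimpleGraph.adj_comm, attachLeaf_adj_leaf, Subtype.coe_inj]
      constructor
      · intro h
        simp [h]
      · rintro (⟨w', -, h⟩ | h)
        · exact absurd h w'.2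
        · by_contra hu
          simp [hu] at h
    · have h1 := attachLeaf_adj_coe (j := j) (u := u) (w := ⟨w, hw⟩) (T := T)
      rw [h1]
      constructor
      · intro h
        exact Or.inl ⟨_, h, rfl⟩
      · rintro (⟨w', h, rfl⟩ | h)
        · exact h
        · split_ifs at h <;> simp [hw] at h
  rw [← SimpleGraph.card_neighborFinset_eq_degree, h, Finset.card_union_of_disjoint,
    Finset.card_map, SimpleGraph.card_neighborFinset_eq_degree]
  · split_ifs <;> simp
  · split_ifs
    · simp
    · simp

open Classical in
theorem degree_attachLeaf_leaf (j : {u // u ≠ v}) (T : SimpleGraph {u // u ≠ v}) :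
    (attachLeaf v j T).degree v = 1 := by
  rw [SimpleGraph.degree_eq_one_iff_existsUnique_adj]
  exact ⟨j, attachLeaf_adj_leaf.2 rfl, fun b hb => attachLeaf_adj_leaf.1 hb⟩

open Classical in
/-- Reduce the excess at `j` by one and forget the vertex `v`. -/
noncomputable def dropLeaf (y : V → ℕ) (v : V) (j : {u // u ≠ v}) : {u // u ≠ v} → ℕ :=
  fun u => if u = j then y u - 1 else y u

open Classical in
/-- Removing the leaf `v` from the trees of a given degree sequence, sorted by the neighbour of
`v`. -/
theorem sum_treesWithExcess_eq_sum_dropLeaf {y : V → ℕ} (hy : y v = 0)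
    (hV : 3 ≤ Fintype.card V) (φ : V → ℝ) (f : ℝ → ℝ) :
    ∑ T ∈ treesWithExcess y, f (edgeProductSum φ T) =
      ∑ j ∈ (Finset.univ : Finset {u // u ≠ v}).filter (fun j : {u // u ≠ v} => 0 < y j), ∑ T ∈ treesWithExcess (dropLeaf y v j),
        f (φ v * φ j + edgeProductSum (fun u : {u // u ≠ v} => φ u) T) := by
  have hcard : Fintype.card {u // u ≠ v} = Fintype.card V - 1 := by
    rw [Fintype.card_subtype_compl, Fintype.card_subtype_eq]
  have : Nontrivial {u // u ≠ v} := Fintype.one_lt_card_iff_nontrivial.1 (by omega)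
  have hnb : ∀ T ∈ treesWithExcess y, ∃ j : {u // u ≠ v}, ∀ b, T.Adj v b ↔ b = j := by
    intro T hT
    have h1 := (Finset.mem_filter.1 hT).2.2 v
    rw [hy, zero_add, SimpleGraph.degree_eq_one_iff_existsUnique_adj] at h1
    obtain ⟨j, hj, hu⟩ := h1
    exact ⟨⟨j, hj.ne'⟩, fun b => ⟨fun hb => hu b hb, fun hb => hb ▸ hj⟩⟩
  rw [Finset.sum_sigma']
  symm
  refine Finset.sum_bij (fun p _ => attachLeaf v p.1 p.2) ?_ ?_ ?_ ?_
  · rintro ⟨j, T⟩ hp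
    simp only [Finset.mem_sigma, Finset.mem_filter, Finset.mem_univ, true_and,
      treesWithExcess] at hp ⊢
    obtain ⟨hj, hT, hd⟩ := hp
    refine ⟨isTree_attachLeaf hT, fun u => ?_⟩
    by_cases hu : u = v
    · subst hu
      rw [hy]
      convert degree_attachLeaf_leaf j T
    · have h1 := degree_attachLeaf j ⟨u, hu⟩ T
      rw [hd, dropLeaf] at h1
      split_ifs at h1 with h2
      · subst h2
        simp only at hj h1
        rw [h1]
        omega
      · simpa using h1
  · rintro ⟨j, T⟩ - ⟨j', T'⟩ - h
    simp only at h
    have h1 : j = j' := by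
      have := (attachLeaf_adj_leaf (j := j) (T := T)).2 rfl
      rw [h, attachLeaf_adj_leaf] at this
      exact Subtype.ext this
    subst h1
    have h2 : T = T' := by rw [← comap_attachLeaf j T, h, comap_attachLeaf]
    subst h2
    rfl
  · intro T hT
    obtain ⟨j, hj⟩ := hnb T hT
    have htree := isTree_comap_of_degree_eq_one (v := v) (Finset.mem_filter.1 hT).2.1
      (by rw [(Finset.mem_filter.1 hT).2.2, hy])
    have heq := attachLeaf_comap hj
    generalize T.comap (Subtype.val : {u // u ≠ v} → V) = T' at htree heq
    subst heq
    have hdeg : ∀ u : {u // u ≠ v}, T'.degree u + (if u = j then 1 else 0) = y u + 1 := by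
      intro u
      rw [← degree_attachLeaf, (Finset.mem_filter.1 hT).2.2]
    -- With at least two vertices left, the neighbour of `v` keeps a positive degree in `T'`, so its
    -- degree in the whole tree was at least two. Hence `0 < y j`; this is where three vertices are
    -- needed.
    have hpos : ∀ u : {u // u ≠ v}, 0 < T'.degree u :=
      fun u => htree.connected.preconnected.degree_pos_of_nontrivial u
    refine ⟨⟨j, T'⟩, ?_, rfl⟩
    simp only [Finset.mem_sigma, Finset.mem_filter, Finset.mem_univ, true_and, treesWithExcess]
    refine ⟨?_, htree, fun u => ?_⟩
    · have h1 := hdeg j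
      have h2 := hpos j
      rw [if_pos rfl] at h1
      omega
    · have h1 := hdeg u
      have h2 := hpos u
      rw [dropLeaf]
      split_ifs at h1 ⊢ <;> omega
  · rintro ⟨j, T⟩ -
    rw [edgeProductSum_attachLeaf]

open Classical in
/-- On two vertices there is a single tree. -/
theorem treesWithExcess_of_card_eq_two {y : V → ℕ} (hy : ∀ u, y u = 0)
    (hV : Fintype.card V = 2) : treesWithExcess y = {⊤} := by
  have : Nontrivial V := Fintype.one_lt_card_iff_nontrivial.1 (by omega)
  ext T
  simp only [treesWithExcess, Finset.mem_filter, Finset.mem_univ, true_and,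
    Finset.mem_singleton]
  constructor
  · rintro ⟨hT, -⟩
    rw [SimpleGraph.eq_top_iff_forall_ne_adj]
    intro u w huw
    obtain ⟨z, hz⟩ := hT.connected.preconnected.exists_adj_of_nontrivial u
    have : z = w := by
      by_contra hzw
      have h3 : ({u, w, z} : Finset V).card ≤ 2 := hV ▸ Finset.card_le_univ _
      rw [Finset.card_eq_three.2 ⟨u, w, z, huw, hz.ne, Ne.symm hzw, rfl⟩] at h3
      omega
    exact this ▸ hz
  · rintro rfl
    refine ⟨⟨SimpleGraph.connected_top, ?_⟩, fun j => ?_⟩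
    · apply SimpleGraph.IsAcyclic.of_card_le_two
      simp [hV]
    · rw [hy]
      convert SimpleGraph.complete_graph_degree j
      rw [hV]

-- The symmetric form avoids naming the two vertices, which suits the base case of the closed form
-- for the mean.
open Classical in
theorem edgeProductSum_top_of_card_eq_two (φ : V → ℝ) (hV : Fintype.card V = 2) :
    edgeProductSum φ ⊤ = ((∑ u, φ u) ^ 2 - ∑ u, φ u ^ 2) / 2 := by
  obtain ⟨a, b, hab, huniv⟩ := Finset.card_eq_two.1 hV
  have h : (⊤ : SimpleGraph V).edgeFinset = {s(a, b)} := by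
    ext e
    induction e using Sym2.ind with
    | _ u w =>
      have hu : u ∈ ({a, b} : Finset V) := huniv ▸ Finset.mem_univ u
      have hw : w ∈ ({a, b} : Finset V) := huniv ▸ Finset.mem_univ w
      simp only [Finset.mem_insert, Finset.mem_singleton] at hu hw
      simp only [SimpleGraph.mem_edgeFinset, SimpleGraph.mem_edgeSet, SimpleGraph.top_adj,
        Finset.mem_singleton, Sym2.eq_iff]
      grind
  unfold edgeProductSum
  have h' := huniv
  rw [Finset.sum_congr (s₂ := {s(a, b)}) (by rw [← h]; ext; simp) (fun _ _ => rfl),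
    Finset.sum_singleton, huniv, Finset.sum_pair hab, Finset.sum_pair hab]
  simp only [Sym2.lift_mk]
  ring

end attachLeaf

/-! ### Counting trees, and the mean of F. -/

section average

universe u

theorem sum_eq_add_sum_subtype_ne {V : Type*} [Fintype V] {v : V} [Fintype {u // u ≠ v}]
    {M : Type*} [AddCommMonoid M] (f : V → M) :
    ∑ u, f u = f v + ∑ u : {u // u ≠ v}, f u := by
  classical
  rw [← Finset.add_sum_erase _ _ (Finset.mem_univ v)]
  congr 1
  exact Finset.sum_subtype _ (by simp) f

section dropLeaf

open Classical

variable {V : Type*} {y : V → ℕ} {v : V} {j : {u // u ≠ v}}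

theorem cast_dropLeaf (hj : 0 < y j) (u : {u // u ≠ v}) :
    (dropLeaf y v j u : ℝ) = y u - if u = j then 1 else 0 := by
  unfold dropLeaf
  split_ifs with h
  · subst h
    push_cast [Nat.cast_sub (show 1 ≤ y u from hj)]
    ring
  · simp

variable [Fintype V]

theorem sum_dropLeaf_mul (hj : 0 < y j) (g : {u // u ≠ v} → ℝ) :
    ∑ u, (dropLeaf y v j u : ℝ) * g u = ∑ u : {u // u ≠ v}, (y u : ℝ) * g u - g j := by
  simp_rw [cast_dropLeaf hj, sub_mul, Finset.sum_sub_distrib]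
  simp

theorem sum_dropLeaf {m : ℕ} (hv : y v = 0) (hj : 0 < y j) (hy : ∑ u, y u = m + 1) :
    ∑ u, dropLeaf y v j u = m := by
  have h := sum_dropLeaf_mul hj fun _ => 1
  rw [sum_eq_add_sum_subtype_ne (v := v), hv, zero_add] at hy
  simp only [mul_one] at h
  have h2 : (∑ u : {u // u ≠ v}, (y u : ℝ)) = m + 1 := by exact_mod_cast hy
  rw [h2] at h
  have h3 : ((∑ u, dropLeaf y v j u : ℕ) : ℝ) = m := by
    push_cast
    linarith
  exact_mod_cast h3

theorem prod_factorial_dropLeaf (hj : 0 < y j) :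
    ∏ u : {u // u ≠ v}, (y u).factorial = y j * ∏ u, (dropLeaf y v j u).factorial := by
  rw [← Finset.mul_prod_erase _ _ (Finset.mem_univ j),
    ← Finset.mul_prod_erase _ (fun u => (dropLeaf y v j u).factorial) (Finset.mem_univ j),
    ← mul_assoc]
  congr 1
  · simp only [dropLeaf, if_true]
    exact (Nat.mul_factorial_pred hj.ne').symm
  · refine Finset.prod_congr rfl fun u hu => ?_
    rw [dropLeaf, if_neg (Finset.ne_of_mem_erase hu)]

theorem prod_eq_mul_prod_subtype_ne {M : Type*} [CommMonoid M] (f : V → M) :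
    ∏ u, f u = f v * ∏ u : {u // u ≠ v}, f u :=
  sum_eq_add_sum_subtype_ne (M := Additive M) f

theorem card_subtype_ne_of_card {m : ℕ} (hV : Fintype.card V = m + 1 + 2) :
    Fintype.card {u // u ≠ v} = m + 2 := by
  rw [Fintype.card_subtype_compl, Fintype.card_subtype_eq]
  omega

end dropLeaf

/-- Supplies the leaf to delete: the total excess is two less than the number of vertices. -/
theorem exists_excess_eq_zero {V : Type*} [Fintype V] {y : V → ℕ}
    (h : ∑ u, y u < Fintype.card V) : ∃ v, y v = 0 := by
  by_contra! hne
  refine absurd h (not_lt.2 ?_)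
  rw [← Finset.card_univ, Finset.card_eq_sum_ones]
  exact Finset.sum_le_sum fun u _ => Nat.one_le_iff_ne_zero.2 (hne u)

open Classical in
theorem card_treesWithExcess_eq_sum {V : Type*} [Fintype V] {y : V → ℕ} {v : V} (hv : y v = 0)
    (hV : 3 ≤ Fintype.card V) :
    (treesWithExcess y).card = ∑ j ∈ (Finset.univ : Finset {u // u ≠ v}).filter
      (fun j : {u // u ≠ v} => 0 < y j), (treesWithExcess (dropLeaf y v j)).card := by
  have h := sum_treesWithExcess_eq_sum_dropLeaf hv hV 0 fun _ => 1
  simp only [Finset.sum_const, nsmul_eq_mul, mul_one] at h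
  exact_mod_cast h

/-- The number of trees with a given degree sequence is a multinomial coefficient. -/
theorem card_treesWithExcess_mul_prod_factorial (m : ℕ) :
    ∀ {V : Type u} [Fintype V] (y : V → ℕ), Fintype.card V = m + 2 → ∑ u, y u = m →
      (treesWithExcess y).card * ∏ u, (y u).factorial = m.factorial := by
  induction m with
  | zero =>
    intro V _ y hV hy
    have h0 : ∀ u, y u = 0 := fun u => (Finset.sum_eq_zero_iff.1 hy) u (Finset.mem_univ u)
    rw [treesWithExcess_of_card_eq_two h0 hV]
    simp [h0]
  | succ m ih =>
    intro V _ y hV hy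
    classical
    obtain ⟨v, hv⟩ := exists_excess_eq_zero (y := y) (by omega)
    rw [card_treesWithExcess_eq_sum hv (by omega), prod_eq_mul_prod_subtype_ne (v := v), hv,
      Nat.factorial_zero, one_mul, Finset.sum_mul, Nat.factorial_succ]
    -- Lowering the excess at `j` divides the factorial product by `y j`, so each neighbour
    -- contributes `y j * m!`; the weights `y j` add up to `m + 1`.
    have h1 : ∀ j ∈ (Finset.univ : Finset {u // u ≠ v}).filter
        (fun j : {u // u ≠ v} => 0 < y j),
        (treesWithExcess (dropLeaf y v j)).card * ∏ u : {u // u ≠ v}, (y u).factorial =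
          y j * m.factorial := by
      intro j hj
      have hj' := (Finset.mem_filter.1 hj).2
      rw [prod_factorial_dropLeaf hj',
        ← ih (dropLeaf y v j) (card_subtype_ne_of_card hV) (sum_dropLeaf hv hj' hy)]
      ring
    rw [Finset.sum_congr rfl h1, ← Finset.sum_mul]
    congr 1
    rw [← hy, sum_eq_add_sum_subtype_ne (v := v), hv, zero_add]
    exact Finset.sum_filter_of_ne fun j _ hj => Nat.pos_of_ne_zero hj

theorem card_treesWithExcess_pos {m : ℕ} {V : Type*} [Fintype V] {y : V → ℕ}
    (hV : Fintype.card V = m + 2) (hy : ∑ u, y u = m) : 0 < (treesWithExcess y).card := by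
  have h := card_treesWithExcess_mul_prod_factorial m y hV hy
  by_contra h0
  have h1 : (treesWithExcess y).card = 0 := by omega
  rw [h1, zero_mul] at h
  exact m.factorial_ne_zero h.symm

open Classical in
/-- The proportion of trees in which the leaf `v` is attached to `j`. -/
theorem succ_mul_card_treesWithExcess_dropLeaf {m : ℕ} {V : Type*} [Fintype V] {y : V → ℕ}
    {v : V} {j : {u // u ≠ v}} (hV : Fintype.card V = m + 1 + 2) (hy : ∑ u, y u = m + 1)
    (hv : y v = 0) (hj : 0 < y j) :
    (m + 1) * (treesWithExcess (dropLeaf y v j)).card = y j * (treesWithExcess y).card := by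
  classical
  have h1 := card_treesWithExcess_mul_prod_factorial (m + 1) y hV hy
  have h2 := card_treesWithExcess_mul_prod_factorial m (dropLeaf y v j)
    (card_subtype_ne_of_card hV) (sum_dropLeaf hv hj hy)
  rw [prod_eq_mul_prod_subtype_ne (v := v), hv, Nat.factorial_zero, one_mul,
    prod_factorial_dropLeaf hj, Nat.factorial_succ, ← h2] at h1
  have hpos : 0 < ∏ u, (dropLeaf y v j u).factorial :=
    Finset.prod_pos fun u _ => Nat.factorial_pos _
  refine Nat.eq_of_mul_eq_mul_right hpos ?_
  linarith

/-- The mean of `f (F T)` over the trees `T` of given degrees, where `F = edgeProductSum φ`. -/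
noncomputable def edgeProductMean {V : Type*} [Fintype V] (y : V → ℕ) (φ : V → ℝ) (f : ℝ → ℝ) :
    ℝ :=
  (∑ T ∈ treesWithExcess y, f (edgeProductSum φ T)) / (treesWithExcess y).card

-- Total expectation over the neighbour of `v`, which is `j` with probability `y j / (m + 1)`. When
-- `y j = 0` the truncated `dropLeaf` has no meaning, but the weight kills the term.
open Classical in
theorem succ_mul_edgeProductMean {m : ℕ} {V : Type*} [Fintype V] {y : V → ℕ}
    {v : V} (hV : Fintype.card V = m + 1 + 2) (hy : ∑ u, y u = m + 1) (hv : y v = 0)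
    (φ : V → ℝ) (f : ℝ → ℝ) :
    (m + 1) * edgeProductMean y φ f = ∑ j : {u // u ≠ v}, y j *
      edgeProductMean (dropLeaf y v j) (fun u => φ u) (fun z => f (φ v * φ j + z)) := by
  have hN : ((treesWithExcess y).card : ℝ) ≠ 0 := by
    exact_mod_cast (card_treesWithExcess_pos hV hy).ne'
  have h0 : ∑ j : {u // u ≠ v}, (y j : ℝ) *
      edgeProductMean (dropLeaf y v j) (fun u => φ u) (fun z => f (φ v * φ j + z)) =
      ∑ j ∈ (Finset.univ : Finset {u // u ≠ v}).filter (fun j : {u // u ≠ v} => 0 < y j),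
        (y j : ℝ) *
          edgeProductMean (dropLeaf y v j) (fun u => φ u) (fun z => f (φ v * φ j + z)) := by
    symm
    refine Finset.sum_filter_of_ne fun j _ hj => Nat.pos_of_ne_zero fun h => hj ?_
    rw [h]
    simp
  rw [h0, edgeProductMean, sum_treesWithExcess_eq_sum_dropLeaf hv (by omega), Finset.sum_div,
    Finset.mul_sum]
  refine Finset.sum_congr rfl fun j hj => ?_
  have hj' := (Finset.mem_filter.1 hj).2
  have hW : ((treesWithExcess (dropLeaf y v j)).card : ℝ) ≠ 0 := by
    exact_mod_cast (card_treesWithExcess_pos (card_subtype_ne_of_card hV)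
      (sum_dropLeaf hv hj' hy)).ne'
  have hr : ((m : ℝ) + 1) * (treesWithExcess (dropLeaf y v j)).card =
      y j * (treesWithExcess y).card := by
    exact_mod_cast succ_mul_card_treesWithExcess_dropLeaf hV hy hv hj'
  unfold edgeProductMean
  rw [mul_div_assoc', mul_div_assoc', div_eq_div_iff hN hW]
  linear_combination (∑ T ∈ treesWithExcess (dropLeaf y v j),
    f (φ v * φ j + edgeProductSum (fun u : {u // u ≠ v} => φ u) T)) * hr

theorem edgeProductMean_const_add {m : ℕ} {V : Type*} [Fintype V] {y : V → ℕ}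
    (hV : Fintype.card V = m + 2) (hy : ∑ u, y u = m) (φ : V → ℝ) (c : ℝ) :
    edgeProductMean y φ (fun z => c + z) = c + edgeProductMean y φ fun z => z := by
  have hN : ((treesWithExcess y).card : ℝ) ≠ 0 := by
    exact_mod_cast (card_treesWithExcess_pos hV hy).ne'
  unfold edgeProductMean
  rw [Finset.sum_add_distrib, Finset.sum_const, nsmul_eq_mul]
  field_simp

theorem edgeProductMean_const_mul {V : Type*} [Fintype V] (y : V → ℕ) (φ : V → ℝ) (c : ℝ)
    (f : ℝ → ℝ) : edgeProductMean y φ (fun z => c * f z) = c * edgeProductMean y φ f := by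
  unfold edgeProductMean
  rw [← Finset.mul_sum, mul_div_assoc]

open Classical in
theorem succ_mul_edgeProductMean_id {m : ℕ} {V : Type*} [Fintype V] {y : V → ℕ}
    {v : V} (hV : Fintype.card V = m + 1 + 2) (hy : ∑ u, y u = m + 1) (hv : y v = 0)
    (φ : V → ℝ) :
    (m + 1) * edgeProductMean y φ (fun z => z) = ∑ j : {u // u ≠ v}, (y j : ℝ) *
      (φ v * φ j + edgeProductMean (dropLeaf y v j) (fun u => φ u) fun z => z) := by
  classical
  rw [succ_mul_edgeProductMean hV hy hv]
  refine Fintype.sum_congr _ _ fun j => ?_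
  rcases Nat.eq_zero_or_pos (y j) with h | h
  · simp [h]
  · rw [edgeProductMean_const_add (card_subtype_ne_of_card hV) (sum_dropLeaf hv h hy)]

/-- The mean of `F`, in closed form. -/
theorem succ_mul_edgeProductMean_id_eq (m : ℕ) :
    ∀ {V : Type u} [Fintype V] (y : V → ℕ) (φ : V → ℝ), Fintype.card V = m + 1 + 2 →
      ∑ u, y u = m + 1 → (m + 1) * edgeProductMean y φ (fun z => z) =
        ∑ u, (y u : ℝ) * (φ u * (∑ w, φ w - φ u)) := by
  induction m with
  | zero =>
    intro V _ y φ hV hy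
    classical
    -- The closed form divides by the total excess, so the induction starts at three vertices;
    -- deleting the leaf leaves a single edge.
    obtain ⟨v, hv⟩ := exists_excess_eq_zero (y := y) (by omega)
    have hW : Fintype.card {u // u ≠ v} = 2 := card_subtype_ne_of_card hV
    rw [succ_mul_edgeProductMean_id hV hy hv,
      sum_eq_add_sum_subtype_ne (v := v) fun u => (y u : ℝ) * _, hv]
    simp only [Nat.cast_zero, zero_mul, zero_add]
    refine Fintype.sum_congr _ _ fun j => ?_
    rcases Nat.eq_zero_or_pos (y j) with h | h
    · simp [h]
    congr 1
    have hd : ∀ u, dropLeaf y v j u = 0 := fun u =>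
      (Finset.sum_eq_zero_iff.1 (sum_dropLeaf hv h hy)) u (Finset.mem_univ u)
    rw [edgeProductMean, treesWithExcess_of_card_eq_two hd hW, Finset.sum_singleton,
      edgeProductSum_top_of_card_eq_two _ hW, Finset.card_singleton, Nat.cast_one, div_one,
      sum_eq_add_sum_subtype_ne (v := v) φ]
    obtain ⟨p, q, hpq, huniv⟩ := Finset.card_eq_two.1 hW
    have hj : j ∈ ({p, q} : Finset {u // u ≠ v}) := huniv ▸ Finset.mem_univ j
    rw [Finset.mem_insert, Finset.mem_singleton] at hj
    rw [huniv, Finset.sum_pair hpq, Finset.sum_pair hpq]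
    rcases hj with rfl | rfl <;> ring
  | succ m ih =>
    intro V _ y φ hV hy
    classical
    obtain ⟨v, hv⟩ := exists_excess_eq_zero (y := y) (by omega)
    have hm : (m : ℝ) + 1 ≠ 0 := by positivity
    have hsum : ∑ u : {u // u ≠ v}, (y u : ℝ) = m + 1 + 1 := by
      rw [sum_eq_add_sum_subtype_ne (v := v), hv, zero_add] at hy
      exact_mod_cast hy
    rw [succ_mul_edgeProductMean_id hV hy hv, sum_eq_add_sum_subtype_ne (v := v), hv,
      sum_eq_add_sum_subtype_ne (v := v) φ]
    set g : {u // u ≠ v} → ℝ := fun u => φ u * (∑ w : {u // u ≠ v}, φ w - φ u) with hg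
    have h1 : ∀ j : {u // u ≠ v}, (y j : ℝ) *
        (φ v * φ j + edgeProductMean (dropLeaf y v j) (fun u => φ u) fun z => z) =
        y j * (φ v * φ j) + y j * ((∑ u : {u // u ≠ v}, (y u : ℝ) * g u) / (m + 1)) -
          y j * g j / (m + 1) := by
      intro j
      rcases Nat.eq_zero_or_pos (y j) with h | h
      · simp [h]
      have h2 := ih (dropLeaf y v j) (fun u => φ u) (card_subtype_ne_of_card hV)
        (sum_dropLeaf hv h hy)
      rw [sum_dropLeaf_mul h g] at h2
      rw [eq_div_of_mul_eq hm ((mul_comm _ _).trans h2)]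
      ring
    rw [Fintype.sum_congr _ _ h1, Finset.sum_sub_distrib, Finset.sum_add_distrib,
      ← Finset.sum_mul, hsum, ← Finset.sum_div]
    have h2 : ∑ u : {u // u ≠ v}, (y u : ℝ) * (φ u * (φ v + ∑ w : {u // u ≠ v}, φ w - φ u)) =
        ∑ u : {u // u ≠ v}, (y u : ℝ) * (φ v * φ u) + ∑ u : {u // u ≠ v}, (y u : ℝ) * g u := by
      rw [← Finset.sum_add_distrib]
      refine Fintype.sum_congr _ _ fun u => ?_
      rw [hg]
      ring
    rw [h2, Nat.cast_zero, zero_mul, zero_add]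
    -- The recursion has become `B + (m + 2) * A / (m + 1) - A / (m + 1) = B + A`.
    generalize ∑ u : {u // u ≠ v}, (y u : ℝ) * g u = A
    generalize ∑ u : {u // u ≠ v}, (y u : ℝ) * (φ v * φ u) = B
    field_simp
    ring

end average

/-! ### Hoeffding's lemma for finite weighted means. -/

section hoeffding

/-- The weights define a `PMF`, under which the centred `d` is sub-Gaussian with parameter `((β - α)
/ 2) ^ 2`. -/
theorem sum_mul_exp_le_of_mem_Icc {ι : Type*} [Fintype ι] {p d : ι → ℝ} (hp : ∀ i, 0 ≤ p i)
    (hp1 : ∑ i, p i = 1) {α β : ℝ} (hd : ∀ i, d i ∈ Set.Icc α β) (s : ℝ) :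
    ∑ i, p i * Real.exp (s * d i) ≤
      Real.exp (s * ∑ i, p i * d i + s ^ 2 / 8 * (β - α) ^ 2) := by
  let _ : MeasurableSpace ι := ⊤
  have : MeasurableSingletonClass ι := ⟨fun _ => trivial⟩
  have hsum : ∑ i, ENNReal.ofReal (p i) = 1 := by
    rw [← ENNReal.ofReal_sum_of_nonneg fun i _ => hp i, hp1, ENNReal.ofReal_one]
  have hint : ∀ f : ι → ℝ,
      ∫ i, f i ∂(PMF.ofFintype (fun i => ENNReal.ofReal (p i)) hsum).toMeasure =
        ∑ i, p i * f i := by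
    intro f
    rw [PMF.integral_eq_sum]
    simp [hp]
  have h := (ProbabilityTheory.hasSubgaussianMGF_of_mem_Icc
    (μ := (PMF.ofFintype (fun i => ENNReal.ofReal (p i)) hsum).toMeasure) (X := d)
    (measurable_of_finite d).aemeasurable (Filter.Eventually.of_forall hd)).mgf_le s
  rw [ProbabilityTheory.mgf, hint, hint] at h
  have h1 : ∑ i, p i * Real.exp (s * d i) = Real.exp (s * ∑ i, p i * d i) *
      ∑ i, p i * Real.exp (s * (d i - ∑ i, p i * d i)) := by
    rw [Finset.mul_sum]
    refine Fintype.sum_congr _ _ fun i => ?_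
    rw [mul_left_comm, ← Real.exp_add]
    congr 2
    ring
  rw [h1, Real.exp_add]
  refine mul_le_mul_of_nonneg_left (h.trans (le_of_eq ?_)) (Real.exp_pos _).le
  congr 1
  push_cast
  rw [Real.norm_eq_abs, div_pow, sq_abs]
  ring

/-- **Hoeffding's lemma** for a finite weighted mean, in terms of the squared spread on the
support of the weights. -/
theorem sum_mul_exp_le_of_sq_sub_le {ι : Type*} [Fintype ι] {p d : ι → ℝ} (hp : ∀ i, 0 ≤ p i)
    (hp1 : ∑ i, p i = 1) {ρ : ℝ}
    (hd : ∀ i j, 0 < p i → 0 < p j → (d i - d j) ^ 2 ≤ ρ) (s : ℝ) :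
    ∑ i, p i * Real.exp (s * d i) ≤ Real.exp (s * ∑ i, p i * d i + s ^ 2 / 8 * ρ) := by
  classical
  have hne : (Finset.univ.filter (fun i => 0 < p i)).Nonempty := by
    by_contra h
    rw [Finset.not_nonempty_iff_eq_empty, Finset.filter_eq_empty_iff] at h
    have : ∑ i, p i = 0 :=
      Finset.sum_eq_zero fun i hi => le_antisymm (not_lt.1 (h hi)) (hp i)
    linarith
  obtain ⟨i₀, hi₀, hmin⟩ := Finset.exists_min_image _ d hne
  obtain ⟨i₁, hi₁, hmax⟩ := Finset.exists_max_image _ d hne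
  -- Values at weight zero are uncontrolled, so they are replaced by the minimum over the support;
  -- no weighted sum changes.
  let d' : ι → ℝ := fun i => if 0 < p i then d i else d i₀
  have hcongr : ∀ f : ℝ → ℝ, ∑ i, p i * f (d i) = ∑ i, p i * f (d' i) := by
    intro f
    refine Fintype.sum_congr _ _ fun i => ?_
    by_cases h : 0 < p i
    · simp only [d', if_pos h]
    · rw [le_antisymm (not_lt.1 h) (hp i), zero_mul, zero_mul]
  have hmem : ∀ i, d' i ∈ Set.Icc (d i₀) (d i₁) := by
    intro i
    simp only [d']
    split_ifs with h
    · exact ⟨hmin i (by simpa using h), hmax i (by simpa using h)⟩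
    · exact ⟨le_rfl, hmax i₀ hi₀⟩
  have h := sum_mul_exp_le_of_mem_Icc hp hp1 hmem s
  rw [hcongr fun z => Real.exp (s * z), hcongr fun z => z]
  refine h.trans (Real.exp_le_exp.2 (add_le_add_right ?_ _))
  exact mul_le_mul_of_nonneg_left
    (hd _ _ (Finset.mem_filter.1 hi₁).2 (Finset.mem_filter.1 hi₀).2) (by positivity)

end hoeffding

/-! ### Exponential moments by successive leaf deletion. -/

section mgf

universe u

open Classical in
/-- The change in the conditional mean of `F` when the leaf `v` is moved from `k` to `j`. -/
theorem mul_edgeProductMean_dropLeaf_sub {m : ℕ} {V : Type*} [Fintype V] {y : V → ℕ}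
    {v : V} {j k : {u // u ≠ v}} (hV : Fintype.card V = m + 1 + 1 + 2)
    (hy : ∑ u, y u = m + 1 + 1) (hv : y v = 0) (hj : 0 < y j) (hk : 0 < y k) (hjk : j ≠ k)
    (φ : V → ℝ) :
    (φ v * φ j + edgeProductMean (dropLeaf y v j) (fun u => φ u) fun z => z) -
      (φ v * φ k + edgeProductMean (dropLeaf y v k) (fun u => φ u) fun z => z) =
      (φ j - φ k) * (φ v -
        (∑ u ∈ ((Finset.univ.erase v).erase (j : V)).erase (k : V), φ u) / (m + 1)) := by
  have hm : (m : ℝ) + 1 ≠ 0 := by positivity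
  have hj' := succ_mul_edgeProductMean_id_eq m (dropLeaf y v j) (fun u => φ u)
    (card_subtype_ne_of_card hV) (sum_dropLeaf hv hj hy)
  have hk' := succ_mul_edgeProductMean_id_eq m (dropLeaf y v k) (fun u => φ u)
    (card_subtype_ne_of_card hV) (sum_dropLeaf hv hk hy)
  rw [sum_dropLeaf_mul hj] at hj'
  rw [sum_dropLeaf_mul hk] at hk'
  have h1 := Finset.add_sum_erase ((Finset.univ.erase v).erase (j : V)) φ (a := (k : V))
    (by simp [k.2, Subtype.coe_inj, hjk.symm])
  have h2 := Finset.add_sum_erase (Finset.univ.erase v) φ (a := (j : V)) (by simp [j.2])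
  have h3 := Finset.add_sum_erase Finset.univ φ (Finset.mem_univ v)
  have h4 := sum_eq_add_sum_subtype_ne (v := v) φ
  field_simp
  -- With `S` the sum of `φ` off `v`, `φ j * (S - φ j) - φ k * (S - φ k) = (φ j - φ k) * (S - φ j -
  -- φ k)`, and the last factor is the sum over the `m + 1` remaining vertices.
  have h5 : ∑ u ∈ ((Finset.univ.erase v).erase (j : V)).erase (k : V), φ u =
      ∑ u : {u // u ≠ v}, φ u - φ j - φ k := by linarith
  rw [h5]
  linear_combination hj' - hk'

/-- The exponential moments of `F`, when the spread of the conditional mean at the removal of the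
leaf `v` is controlled by `w v` and by the number of other remaining vertices. -/
theorem edgeProductMean_exp_le {h : ℕ → ℝ} (hh : ∀ i, 0 ≤ h i) (s : ℝ) (m : ℕ) :
    ∀ {V : Type u} [Fintype V] (y : V → ℕ) (φ w : V → ℝ), (∀ v, 0 ≤ w v) →
      (∀ v j k, ∀ R : Finset V, R.Nonempty →
        ((φ j - φ k) * (φ v - (∑ u ∈ R, φ u) / R.card)) ^ 2 ≤ w v + h R.card) →
      Fintype.card V = m + 2 → ∑ u, y u = m →
      edgeProductMean y φ (fun z => Real.exp (s * z)) ≤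
        Real.exp (s * edgeProductMean y φ (fun z => z) +
          s ^ 2 / 8 * (∑ v, w v + ∑ i ∈ Finset.range m, h i)) := by
  induction m with
  | zero =>
    intro V _ y φ w hw _ hV hy
    have h0 : ∀ u, y u = 0 := fun u => (Finset.sum_eq_zero_iff.1 hy) u (Finset.mem_univ u)
    have hW : 0 ≤ ∑ v, w v := Finset.sum_nonneg fun v _ => hw v
    rw [edgeProductMean, edgeProductMean, treesWithExcess_of_card_eq_two h0 hV]
    simp only [Finset.sum_singleton, Finset.card_singleton, Nat.cast_one, div_one]
    refine Real.exp_le_exp.2 (le_add_of_nonneg_right ?_)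
    simp only [Finset.range_zero, Finset.sum_empty, add_zero]
    positivity
  | succ m ih =>
    intro V _ y φ w hw hR hV hy
    classical
    obtain ⟨v, hv⟩ := exists_excess_eq_zero (y := y) (by omega)
    have hm : (m : ℝ) + 1 ≠ 0 := by positivity
    set B := ∑ u : {u // u ≠ v}, w u + ∑ i ∈ Finset.range m, h i with hB
    set d : {u // u ≠ v} → ℝ := fun j =>
      φ v * φ j + edgeProductMean (dropLeaf y v j) (fun u => φ u) fun z => z with hd
    have hmean : edgeProductMean y φ (fun z => z) =
        ∑ j : {u // u ≠ v}, (y j / (m + 1) : ℝ) * d j := by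
      rw [← mul_right_inj' hm, succ_mul_edgeProductMean_id hV hy hv, Finset.mul_sum]
      refine Fintype.sum_congr _ _ fun j => ?_
      field_simp
      rfl
    have hexp : edgeProductMean y φ (fun z => Real.exp (s * z)) ≤
        Real.exp (s ^ 2 / 8 * B) *
          ∑ j : {u // u ≠ v}, (y j / (m + 1) : ℝ) * Real.exp (s * d j) := by
      rw [← mul_le_mul_iff_right₀ (show (0 : ℝ) < m + 1 by positivity),
        succ_mul_edgeProductMean hV hy hv, Finset.mul_sum, Finset.mul_sum]
      refine Finset.sum_le_sum fun j _ => ?_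
      rcases Nat.eq_zero_or_pos (y j) with h0 | h0
      · simp [h0]
      -- The spread hypothesis speaks of all nonempty `R`, so it passes to the smaller vertex set
      -- with the same `h`.
      have h1 := ih (dropLeaf y v j) (fun u => φ u) (fun u => w u) (fun u => hw u)
        (fun a b c R hRne => by
          have h2 := hR a b c (R.map (Function.Embedding.subtype _)) (by simpa using hRne)
          simpa using h2)
        (card_subtype_ne_of_card hV) (sum_dropLeaf hv h0 hy)
      have h2 : edgeProductMean (dropLeaf y v j) (fun u => φ u)
          (fun z => Real.exp (s * (φ v * φ j + z))) = Real.exp (s * (φ v * φ j)) *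
          edgeProductMean (dropLeaf y v j) (fun u => φ u) (fun z => Real.exp (s * z)) := by
        rw [← edgeProductMean_const_mul]
        simp only [mul_add, Real.exp_add]
      rw [h2]
      refine (mul_le_mul_of_nonneg_left (mul_le_mul_of_nonneg_left h1 (Real.exp_pos _).le)
        (Nat.cast_nonneg _)).trans (le_of_eq ?_)
      have h3 : Real.exp (s ^ 2 / 8 * B) * Real.exp (s * d j) = Real.exp (s * (φ v * φ j)) *
          Real.exp (s * edgeProductMean (dropLeaf y v j) (fun u => φ u) (fun z => z) +
            s ^ 2 / 8 * B) := by
        rw [← Real.exp_add, ← Real.exp_add]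
        congr 1
        simp only [hd]
        ring
      rw [← h3]
      field_simp
    have hspread : ∀ j k : {u // u ≠ v}, 0 < (y j / (m + 1) : ℝ) → 0 < (y k / (m + 1) : ℝ) →
        (d j - d k) ^ 2 ≤ w v + h m := by
      intro j k hj hk
      rcases eq_or_ne j k with rfl | hjk
      · rw [sub_self, sq, mul_zero]
        exact add_nonneg (hw v) (hh m)
      have hpos : ∀ i : {u // u ≠ v}, 0 < (y i / (m + 1) : ℝ) → 0 < y i := fun i hi =>
        Nat.pos_of_ne_zero fun h0 => by simp [h0] at hi
      have hj' := hpos j hj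
      have hk' := hpos k hk
      -- If the total excess is one, there cannot be two distinct possible neighbours; otherwise `R`
      -- is nonempty and the average makes sense.
      obtain _ | m := m
      · have h1 : (y j + y k : ℕ) ≤ ∑ u, y u := by
          rw [← Finset.sum_pair (f := y) (Subtype.coe_injective.ne hjk)]
          exact Finset.sum_le_sum_of_subset (Finset.subset_univ _)
        omega
      have hcard : (((Finset.univ.erase v).erase (j : V)).erase (k : V)).card = m + 1 := by
        rw [Finset.card_erase_of_mem (by simp [k.2, Subtype.coe_inj, hjk.symm]),
          Finset.card_erase_of_mem (by simp [j.2]),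
          Finset.card_erase_of_mem (Finset.mem_univ v), Finset.card_univ, hV]
        omega
      have h1 := hR v j k (((Finset.univ.erase v).erase (j : V)).erase (k : V))
        (Finset.card_pos.1 (by omega))
      rw [hcard] at h1
      push_cast at h1
      rw [hd]
      rw [mul_edgeProductMean_dropLeaf_sub hV hy hv hj' hk' hjk φ]
      exact h1
    have hsum : ∑ j : {u // u ≠ v}, (y j / (m + 1) : ℝ) = 1 := by
      rw [← Finset.sum_div, div_eq_one_iff_eq hm]
      rw [sum_eq_add_sum_subtype_ne (v := v), hv, zero_add] at hy
      exact_mod_cast hy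
    refine hexp.trans ?_
    have h3 := sum_mul_exp_le_of_sq_sub_le (fun j : {u // u ≠ v} => by positivity) hsum hspread s
    refine (mul_le_mul_of_nonneg_left h3 (Real.exp_pos _).le).trans (le_of_eq ?_)
    rw [← Real.exp_add, hmean, sum_eq_add_sum_subtype_ne (v := v) w, Finset.sum_range_succ, hB]
    congr 1
    ring

end mgf

/-! ### Bounding the total squared spread. -/

theorem sum_range_inv_le (m : ℕ) {n : ℕ} (hm : m ≤ n) :
    ∑ i ∈ Finset.range m, (i : ℝ)⁻¹ ≤ 1 + Real.log n := by
  have hlog : 0 ≤ Real.log n := Real.log_natCast_nonneg n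
  obtain _ | m := m
  · simp only [Finset.range_zero, Finset.sum_empty]
    linarith
  have h := harmonic_le_one_add_log m
  rw [harmonic] at h
  push_cast at h
  -- The term `i = 0` is `0⁻¹ = 0`, which leaves a harmonic number.
  rw [Finset.sum_range_succ', Nat.cast_zero, inv_zero, add_zero]
  push_cast
  refine h.trans (add_le_add_right ?_ _)
  obtain _ | m := m
  · simpa using hlog
  · exact Real.log_le_log (by positivity) (by exact_mod_cast (by omega : m + 1 ≤ n))

section bounds

variable {V : Type*} [Fintype V] {a b : ℝ} {φ : V → ℝ}

theorem abs_sub_le_of_mem_Icc_of_mem_Icc {p q : ℝ} (hp : p ∈ Set.Icc a b)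
    (hq : q ∈ Set.Icc a b) : |p - q| ≤ b - a :=
  abs_le.2 ⟨by linarith [hp.1, hq.2], by linarith [hp.2, hq.1]⟩

omit [Fintype V] in
theorem sum_div_card_mem_Icc (hφ : ∀ v, φ v ∈ Set.Icc a b) {R : Finset V} (hR : R.Nonempty) :
    (∑ u ∈ R, φ u) / R.card ∈ Set.Icc a b := by
  have hpos : (0 : ℝ) < R.card := by exact_mod_cast hR.card_pos
  constructor
  · rw [le_div_iff₀ hpos, mul_comm, ← nsmul_eq_mul]
    exact Finset.card_nsmul_le_sum _ _ _ fun u _ => (hφ u).1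
  · rw [div_le_iff₀ hpos, mul_comm, ← nsmul_eq_mul]
    exact Finset.sum_le_card_nsmul _ _ _ fun u _ => (hφ u).2

theorem abs_sum_div_card_sub_le (φ : V → ℝ) (c : ℝ) {R : Finset V} (hR : R.Nonempty) :
    |(∑ u ∈ R, φ u) / R.card - c| ≤ (∑ u, |φ u - c|) * (R.card : ℝ)⁻¹ := by
  have hpos : (0 : ℝ) < R.card := by exact_mod_cast hR.card_pos
  have h : (∑ u ∈ R, φ u) / R.card - c = (∑ u ∈ R, (φ u - c)) * (R.card : ℝ)⁻¹ := by
    rw [Finset.sum_sub_distrib, Finset.sum_const, nsmul_eq_mul]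
    field_simp
  rw [h, abs_mul, abs_of_pos (inv_pos.2 hpos)]
  refine mul_le_mul_of_nonneg_right ?_ (inv_pos.2 hpos).le
  exact (Finset.abs_sum_le_sum_abs _ _).trans
    (Finset.sum_le_univ_sum_of_nonneg fun u => abs_nonneg _)

variable {y : V → ℕ} {m : ℕ}

/-- Both factors of the change in the mean are at most `b - a`, so each vertex is charged `(b - a) ^
4` and `h = 0`. -/
theorem edgeProductMean_exp_le_card (hφ : ∀ v, φ v ∈ Set.Icc a b)
    (hV : Fintype.card V = m + 2) (hy : ∑ u, y u = m) (s : ℝ) :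
    edgeProductMean y φ (fun z => Real.exp (s * z)) ≤
      Real.exp (s * edgeProductMean y φ (fun z => z) +
        s ^ 2 / 8 * ((b - a) ^ 3 * ((b - a) * Fintype.card V))) := by
  have h := edgeProductMean_exp_le (h := fun _ => 0) (fun _ => le_rfl) s m y φ
    (fun _ => (b - a) ^ 4) (fun _ => by positivity) (fun v j k R hR => ?_) hV hy
  · simp only [Finset.sum_const, Finset.card_univ, nsmul_eq_mul, smul_zero, add_zero] at h
    refine h.trans (le_of_eq ?_)
    congr 1
    ring
  · rw [add_zero, mul_pow, show (b - a) ^ 4 = (b - a) ^ 2 * (b - a) ^ 2 by ring, ← sq_abs,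
      ← sq_abs (φ v - _)]
    have h1 := abs_sub_le_of_mem_Icc_of_mem_Icc (hφ j) (hφ k)
    have h2 := abs_sub_le_of_mem_Icc_of_mem_Icc (hφ v) (sum_div_card_mem_Icc hφ hR)
    gcongr

/-- Of the four factors in the squared change, three are bounded by `b - a`; one copy of the
distance from `φ v` to the average over `R` is split at `c`. The part `|φ v - c|` is charged to `v`,
the part `M / |R|` to the size of `R`. -/
theorem edgeProductMean_exp_le_log (hφ : ∀ v, φ v ∈ Set.Icc a b) (hab : a ≤ b) (c : ℝ)
    (hV : Fintype.card V = m + 2) (hy : ∑ u, y u = m) (s : ℝ) :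
    edgeProductMean y φ (fun z => Real.exp (s * z)) ≤
      Real.exp (s * edgeProductMean y φ (fun z => z) +
        s ^ 2 / 8 * ((b - a) ^ 3 * ((∑ v, |φ v - c|) * (Real.log (Fintype.card V) + 2)))) := by
  have hba : 0 ≤ b - a := sub_nonneg.2 hab
  set M := ∑ v, |φ v - c| with hM
  have hM0 : 0 ≤ M := Finset.sum_nonneg fun v _ => abs_nonneg _
  have h := edgeProductMean_exp_le (h := fun i => (b - a) ^ 3 * (M * (i : ℝ)⁻¹))
    (fun i => by positivity) s m y φ (fun v => (b - a) ^ 3 * |φ v - c|)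
    (fun _ => by positivity) (fun v j k R hR => ?_) hV hy
  · refine h.trans (Real.exp_le_exp.2 (add_le_add_right ?_ _))
    rw [← Finset.mul_sum, ← Finset.mul_sum, ← Finset.mul_sum, ← hM, ← mul_add]
    have h1 := sum_range_inv_le m (n := Fintype.card V) (by omega)
    have h2 : M + M * ∑ i ∈ Finset.range m, (i : ℝ)⁻¹ ≤
        M * (Real.log (Fintype.card V) + 2) := by
      nlinarith
    gcongr
  · have h1 := abs_sub_le_of_mem_Icc_of_mem_Icc (hφ j) (hφ k)
    have h2 := abs_sub_le_of_mem_Icc_of_mem_Icc (hφ v) (sum_div_card_mem_Icc hφ hR)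
    have h3 : |φ v - (∑ u ∈ R, φ u) / R.card| ≤ |φ v - c| + M * (R.card : ℝ)⁻¹ := by
      have h4 := abs_sub_le (φ v) c ((∑ u ∈ R, φ u) / R.card)
      have h5 := abs_sum_div_card_sub_le φ c hR
      rw [abs_sub_comm] at h5
      linarith
    rw [mul_pow, ← sq_abs, ← sq_abs (φ v - _), ← mul_add]
    calc |φ j - φ k| ^ 2 * |φ v - (∑ u ∈ R, φ u) / R.card| ^ 2
        ≤ (b - a) ^ 2 * ((b - a) * (|φ v - c| + M * (R.card : ℝ)⁻¹)) := by
          rw [sq |φ v - _|]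
          gcongr
      _ = _ := by ring

end bounds

/-! ### Jensen and Chernoff bounds over a finite set. -/

section chernoff

variable {α : Type*} {S : Finset α} {F : α → ℝ} {μ L : ℝ}

/-- Jensen's inequality for the exponential of a finite mean. -/
theorem exp_mul_mean_le (hS : S.Nonempty) (F : α → ℝ) (s : ℝ) :
    Real.exp (s * ((∑ i ∈ S, F i) / S.card)) ≤ (∑ i ∈ S, Real.exp (s * F i)) / S.card := by
  have hpos : (0 : ℝ) < S.card := by exact_mod_cast hS.card_pos
  have h := convexOn_exp.map_sum_le (t := S) (w := fun _ => (S.card : ℝ)⁻¹)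
    (p := fun i => s * F i) (fun _ _ => by positivity)
    (by rw [Finset.sum_const, nsmul_eq_mul, mul_inv_cancel₀ hpos.ne']) (fun _ _ => trivial)
  simp only [smul_eq_mul, ← Finset.mul_sum] at h
  rwa [mul_left_comm, inv_mul_eq_div, inv_mul_eq_div] at h

/-- Markov's inequality for the exponential of a deviation in either direction. -/
theorem card_filter_abs_sub_div_card_le (hS : S.Nonempty)
    (h : ∀ s, (∑ i ∈ S, Real.exp (s * F i)) / S.card ≤ Real.exp (s * μ + s ^ 2 / 8 * L))
    {s : ℝ} (hs : 0 ≤ s) (t : ℝ) [DecidablePred fun i => t < |F i - μ|] :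
    ((S.filter fun i => t < |F i - μ|).card : ℝ) / S.card ≤
      2 * Real.exp (s ^ 2 / 8 * L - s * t) := by
  have hpos : (0 : ℝ) < S.card := by exact_mod_cast hS.card_pos
  -- According to the sign of the deviation, one of the two exponentials is at least one.
  have hi : ∀ i ∈ S.filter fun i => t < |F i - μ|, (1 : ℝ) ≤
      Real.exp (-(s * t) - s * μ) * Real.exp (s * F i) +
        Real.exp (-(s * t) + s * μ) * Real.exp (-s * F i) := by
    intro i hi
    have hi' := (Finset.mem_filter.1 hi).2.le
    rw [← Real.exp_add, ← Real.exp_add]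
    rcases abs_cases (F i - μ) with ⟨h1, -⟩ | ⟨h1, -⟩
    · rw [h1] at hi'
      have := Real.one_le_exp (x := -(s * t) - s * μ + s * F i) (by nlinarith)
      linarith [Real.exp_pos (-(s * t) + s * μ + -s * F i)]
    · rw [h1] at hi'
      have := Real.one_le_exp (x := -(s * t) + s * μ + -s * F i) (by nlinarith)
      linarith [Real.exp_pos (-(s * t) - s * μ + s * F i)]
  have h1 : ((S.filter fun i => t < |F i - μ|).card : ℝ) ≤
      ∑ i ∈ S, (Real.exp (-(s * t) - s * μ) * Real.exp (s * F i) +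
        Real.exp (-(s * t) + s * μ) * Real.exp (-s * F i)) := by
    have h2 := Finset.card_nsmul_le_sum _ _ _ hi
    rw [nsmul_eq_mul, mul_one] at h2
    exact h2.trans (Finset.sum_le_sum_of_subset_of_nonneg (Finset.filter_subset _ _)
      fun i _ _ => by positivity)
  rw [Finset.sum_add_distrib, ← Finset.mul_sum, ← Finset.mul_sum] at h1
  have h2 := mul_le_mul_of_nonneg_left (h s) (Real.exp_pos (-(s * t) - s * μ)).le
  have h3 := mul_le_mul_of_nonneg_left (h (-s)) (Real.exp_pos (-(s * t) + s * μ)).le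
  rw [← Real.exp_add] at h2 h3
  rw [show -(s * t) - s * μ + (s * μ + s ^ 2 / 8 * L) = s ^ 2 / 8 * L - s * t by ring] at h2
  rw [show -(s * t) + s * μ + (-s * μ + (-s) ^ 2 / 8 * L) = s ^ 2 / 8 * L - s * t by ring] at h3
  refine (div_le_div_of_nonneg_right h1 hpos.le).trans ?_
  rw [add_div, mul_div_assoc, mul_div_assoc]
  linarith

theorem card_filter_abs_sub_div_card_le_exp (hS : S.Nonempty) (hL : 0 < L)
    (h : ∀ s, (∑ i ∈ S, Real.exp (s * F i)) / S.card ≤ Real.exp (s * μ + s ^ 2 / 8 * L))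
    {t : ℝ} (ht : 0 ≤ t) [DecidablePred fun i => t < |F i - μ|] :
    ((S.filter fun i => t < |F i - μ|).card : ℝ) / S.card ≤
      2 * Real.exp (-(2 * t ^ 2) / L) := by
  -- The choice `s = 4 * t / L` minimises the exponent `s ^ 2 / 8 * L - s * t`.
  refine (card_filter_abs_sub_div_card_le hS h (s := 4 * t / L) (by positivity) t).trans
    (le_of_eq ?_)
  congr 2
  field_simp
  ring

/-- For `L = 0` the bound is `2 * exp (-(s * t))` for every `s ≥ 0`; let `s` tend to infinity. -/
theorem card_filter_abs_sub_div_card_eq_zero (hS : S.Nonempty)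
    (h : ∀ s, (∑ i ∈ S, Real.exp (s * F i)) / S.card ≤ Real.exp (s * μ))
    {t : ℝ} (ht : 0 < t) [DecidablePred fun i => t < |F i - μ|] :
    ((S.filter fun i => t < |F i - μ|).card : ℝ) / S.card = 0 := by
  refine le_antisymm ?_ (by positivity)
  have hlim : Filter.Tendsto (fun s : ℝ => 2 * Real.exp (-(s * t))) Filter.atTop (nhds 0) := by
    have := (Real.tendsto_exp_neg_atTop_nhds_zero.comp
      (Filter.tendsto_id.atTop_mul_const ht)).const_mul 2
    simpa using this
  refine ge_of_tendsto hlim ((Filter.eventually_ge_atTop 0).mono fun s hs => ?_)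
  have := card_filter_abs_sub_div_card_le (L := 0) hS (by simpa using h) hs t
  simpa using this

end chernoff

/-! ### Back to degree sequences on `Fin n`. -/

theorem trees_eq_treesWithExcess {n : ℕ} {x : Fin n → ℕ} (hx : ∀ j, 0 < x j) :
    TreeDegree.trees x = treesWithExcess fun j => x j - 1 := by
  ext T
  simp only [TreeDegree.trees, treesWithExcess, Finset.mem_filter, Finset.mem_univ, true_and,
    Nat.sub_add_cancel (hx _)]

theorem treeAverage_eq_edgeProductMean {n : ℕ} {x : Fin n → ℕ} (hx : ∀ j, 0 < x j)
    (φ : Fin n → ℝ) (f : ℝ → ℝ) :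
    TreeDegree.treeAverage x (fun T => f (TreeDegree.edgeSum φ T)) =
      edgeProductMean (fun j => x j - 1) φ f := by
  rw [TreeDegree.treeAverage, trees_eq_treesWithExcess hx, edgeProductMean, one_div,
    inv_mul_eq_div]
  rfl

theorem rangeBound_nonneg {n : ℕ} {a b : ℝ} (hab : a ≤ b) (φ : Fin n → ℝ) :
    0 ≤ TreeDegree.rangeBound φ a b := by
  have hba : 0 ≤ b - a := sub_nonneg.2 hab
  have hM : 0 ≤ TreeDegree.medianSeminorm φ :=
    Real.iInf_nonneg fun c => Finset.sum_nonneg fun v _ => abs_nonneg _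
  have hlog : 0 ≤ Real.log n := Real.log_natCast_nonneg n
  unfold TreeDegree.rangeBound
  positivity

theorem edgeProductMean_exp_le_rangeBound {n m : ℕ} {a b : ℝ} {φ : Fin n → ℝ}
    (hφ : ∀ j, φ j ∈ Set.Icc a b) (hab : a ≤ b) {y : Fin n → ℕ} (hn : n = m + 2)
    (hy : ∑ j, y j = m) (s : ℝ) :
    edgeProductMean y φ (fun z => Real.exp (s * z)) ≤
      Real.exp (s * edgeProductMean y φ (fun z => z) +
        s ^ 2 / 8 * TreeDegree.rangeBound φ a b) := by
  have hV : Fintype.card (Fin n) = m + 2 := by rw [Fintype.card_fin, hn]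
  obtain ⟨c, hc⟩ := (TreeDegree.medianSeminorm_isLeast φ).1
  unfold TreeDegree.rangeBound
  rcases min_choice ((b - a) * n) (TreeDegree.medianSeminorm φ * (Real.log n + 2)) with h | h
  · rw [h]
    simpa using edgeProductMean_exp_le_card hφ hV hy s
  · rw [h, ← hc]
    simpa using edgeProductMean_exp_le_log hφ hab c hV hy s

/-- When `rangeBound φ a b = 0`, division by zero turns the tail bound into the trivial `2`; the
last clause supplies the intended value `0`. -/
theorem theorem3p1 (n : ℕ) (a b : ℝ) (φ : Fin n → ℝ) (hφ : ∀ j, φ j ∈ Set.Icc a b)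
    (x : Fin n → ℕ) (hx : TreeDegree.IsTreeDegreeSeq x) :
    (∀ ξ : ℝ, ξ = 1 ∨ ξ = -1 →
      ∃ K : ℝ, 0 ≤ K ∧ K ≤ 1 / 8 * TreeDegree.rangeBound φ a b ∧
        TreeDegree.treeAverage x (fun T => Real.exp (ξ * TreeDegree.edgeSum φ T)) =
          Real.exp (ξ * TreeDegree.treeAverage x (TreeDegree.edgeSum φ) + K)) ∧
    ∀ t : ℝ, 0 < t →
      TreeDegree.treeProb x
          (fun T => t < |TreeDegree.edgeSum φ T - TreeDegree.treeAverage x (TreeDegree.edgeSum φ)|)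
        ≤ 2 * Real.exp (-(2 * t ^ 2) / TreeDegree.rangeBound φ a b) ∧
      (TreeDegree.rangeBound φ a b = 0 →
        TreeDegree.treeProb x
          (fun T => t < |TreeDegree.edgeSum φ T - TreeDegree.treeAverage x (TreeDegree.edgeSum φ)|)
        = 0) := by
  obtain ⟨hpos, hsum⟩ := hx
  set y : Fin n → ℕ := fun j => x j - 1 with hy
  have hy1 : ∑ j, y j + n = ∑ j, x j := by
    have h : ∑ j, (y j + 1) = ∑ j, x j :=
      Finset.sum_congr rfl fun j _ => Nat.sub_add_cancel (hpos j)
    simpa [Finset.sum_add_distrib] using h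
  -- In particular `n ≥ 2`: a single vertex admits no positive sequence with sum zero. A vertex
  -- therefore exists, and `a ≤ b` follows.
  have hn : n = ∑ j, y j + 2 := by omega
  have hab : a ≤ b := (hφ ⟨0, by omega⟩).1.trans (hφ ⟨0, by omega⟩).2
  have hne : (TreeDegree.trees x).Nonempty := by
    rw [trees_eq_treesWithExcess hpos]
    exact Finset.card_pos.1
      (card_treesWithExcess_pos (m := ∑ j, y j) (by rw [Fintype.card_fin]; exact hn) rfl)
  have hL := rangeBound_nonneg hab φ
  have hmean : ∀ g, TreeDegree.treeAverage x g =
      (∑ T ∈ TreeDegree.trees x, g T) / (TreeDegree.trees x).card := fun g => by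
    rw [TreeDegree.treeAverage, one_div, inv_mul_eq_div]
  have hupper : ∀ s, TreeDegree.treeAverage x (fun T => Real.exp (s * TreeDegree.edgeSum φ T)) ≤
      Real.exp (s * TreeDegree.treeAverage x (TreeDegree.edgeSum φ) +
        s ^ 2 / 8 * TreeDegree.rangeBound φ a b) := by
    intro s
    have h := edgeProductMean_exp_le_rangeBound hφ hab hn rfl s
    rwa [← treeAverage_eq_edgeProductMean hpos, ← treeAverage_eq_edgeProductMean hpos] at h
  have hupper' := hupper
  simp only [hmean fun T => Real.exp _] at hupper'
  refine ⟨fun ξ hξ => ?_, fun t ht => ⟨?_, fun h0 => ?_⟩⟩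
  · have hlower : Real.exp (ξ * TreeDegree.treeAverage x (TreeDegree.edgeSum φ)) ≤
        TreeDegree.treeAverage x (fun T => Real.exp (ξ * TreeDegree.edgeSum φ T)) := by
      rw [hmean, hmean]
      exact exp_mul_mean_le hne _ ξ
    have hup := hupper ξ
    have hpos' := (Real.exp_pos _).trans_le hlower
    rw [← Real.le_log_iff_exp_le hpos'] at hlower
    rw [← Real.log_le_iff_le_exp hpos'] at hup
    have hsq : ξ ^ 2 = 1 := by rcases hξ with rfl | rfl <;> norm_num
    rw [hsq] at hup
    -- `K` is forced by the identity; it is nonnegative by Jensen and bounded above by the moment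
    -- estimate at `s = ξ`.
    refine ⟨Real.log (TreeDegree.treeAverage x fun T => Real.exp (ξ * TreeDegree.edgeSum φ T)) -
      ξ * TreeDegree.treeAverage x (TreeDegree.edgeSum φ), by linarith, by linarith, ?_⟩
    rw [add_sub_cancel, Real.exp_log hpos']
  · rcases hL.eq_or_lt with h0 | h0
    · rw [← h0] at hupper' ⊢
      refine (card_filter_abs_sub_div_card_eq_zero hne (by simpa using hupper') ht).le.trans ?_
      positivity
    · exact card_filter_abs_sub_div_card_le_exp hne h0 hupper' ht.le
  · rw [h0] at hupper'
    exact card_filter_abs_sub_div_card_eq_zero hne (by simpa using hupper') ht
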